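/- An operation on $\{0,1\}$ is a map $f:\{0,1\}^t\to\{0,1\}$ with $t\ge 1$; it acts coordinatewise on $t$-tuples of vectors in $\{0,1\}^n$. A (Boolean) clone is a set of operations that contains all projections and is closed under composition; $\langle G\rangle$ denotes the clone generated by $G$. For a set $\mathcal F$ of operations and $\mathcal S\subseteq\{0,1\}^n$, let $Cl_{\mathcal F}(\mathcal S)$ be the smallest set of vectors that contains $\mathcal S$ and is closed under the coordinatewise action of the operations in $\mathcal F$. For a fixed $\mathcal F$, the problem $\textsc{Closure}_{\mathcal F}$ is: given $n$, $m$, a vector $v\in\{0,1\}^n$ and a set $\mathcal S\subseteq\{0,1\}^n$ presented as a list of $m$ vectors, decide whether $v\in Cl_{\mathcal F}(\mathcal S)$. For $k\ge 2$ let $Th_k^{k+1}:\{0,1\}^{k+1}\to\{0,1\}$ be the threshold function that is $1$ if and only if at least $k$ of its $k+1$ arguments are $1$. Put $$S_{10}^k=\langle Th_k^{k+1},\,x\wedge(y\vee z)\rangle,\quad S_{12}^k=\langle Th_k^{k+1},\,x\wedge(y\to z)\rangle,\quad D_1=\langle maj,\,x+y+z\rangle,$$ where $maj=Th_2^3$ is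 the ternary majority and $+$ is addition modulo $2$. The computational model is the random access machine with indirect addressing, addition, subtraction and multiplication. It works on natural numbers, subtraction being truncated at $0$, and it has random access to the input. A time bound $O(T)$ means that some program (depending only on the problem) solves every instance in at most $c\,(T+1)$ unit-cost steps, with all registers holding numbers of at most $c\log N$ bits, where $c$ is a constant and $N$ bounds the number of input registers and the numbers in them. $\mathsf P$ is the class of problems solvable by such a machine in polynomially many steps on numbers of polynomially many bits, with respect to the bit size of the input. Let $k\ge 2$ and let $\mathcal F$ be a Boolean clone with $Th_k^{k+1}\in\mathcal F$. Then $\textsc{Closure}_{\mathcal F}$ is solvable in time $O(mn^k)$. In particular, $\textsc{Closure}_{S_{10}^k}$ and $\textsc{Closure}_{S_{12}^k}$ (for every $k\ge2$) and $\textsc{Closure}_{D_1}$ are in $\mathsf P$. -/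

import Mathlib

namespace CloneClosure

/-! ### Operations, clones, closures -/

/-- A `t`-ary operation on `D`, with `t ≥ 1`. -/
structure Operation (D : Type) where
  arity : ℕ
  arity_pos : 0 < arity
  toFun : (Fin arity → D) → D

/-- The coordinatewise extension of an operation to vectors of size `n`. -/
def Operation.onVectors {D : Type} (f : Operation D) {n : ℕ}
    (w : Fin f.arity → (Fin n → D)) : Fin n → D :=
  fun i => f.toFun (fun j => w j i)

/-- The projection of arity `t` onto coordinate `i`. -/
def Operation.proj {D : Type} {t : ℕ} (i : Fin t) : Operation D :=
  ⟨t, i.pos, fun x => x i⟩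

/-- The composition `x ↦ f (g₁ x, …, gₛ x)` of an `s`-ary `f` with `t`-ary `g₁, …, gₛ`. -/
def Operation.comp {D : Type} (f : Operation D) {t : ℕ} (ht : 0 < t)
    (g : Fin f.arity → (Fin t → D) → D) : Operation D :=
  ⟨t, ht, fun x => f.toFun (fun j => g j x)⟩

/-- A (functional) clone: a set of operations that contains all projections and is closed under
composition. -/
structure IsClone {D : Type} (F : Set (Operation D)) : Prop where
  proj_mem : ∀ {t : ℕ} (i : Fin t), Operation.proj i ∈ F
  comp_mem : ∀ (f : Operation D) {t : ℕ} (ht : 0 < t) (g : Fin f.arity → (Fin t → D) → D),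
    f ∈ F → (∀ j, (⟨t, ht, g j⟩ : Operation D) ∈ F) → f.comp ht g ∈ F

/-- `IsGenerated F f`: the operation `f` is obtained by composition from operations in `F` and
projections. -/
inductive IsGenerated {D : Type} (F : Set (Operation D)) : Operation D → Prop
  | basic (f : Operation D) (hf : f ∈ F) : IsGenerated F f
  | proj {t : ℕ} (i : Fin t) : IsGenerated F (Operation.proj i)
  | comp (f : Operation D) {t : ℕ} (ht : 0 < t) (g : Fin f.arity → (Fin t → D) → D)
      (hf : IsGenerated F f) (hg : ∀ j, IsGenerated F ⟨t, ht, g j⟩) :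
      IsGenerated F (f.comp ht g)

/-- The clone `⟨F⟩` generated by `F`. -/
def generatedClone {D : Type} (F : Set (Operation D)) : Set (Operation D) :=
  {f | IsGenerated F f}

/-- Membership in the closure `Cl_F(S)`: the smallest set of vectors that contains `S` and is
closed under the coordinatewise action of the operations of `F`. -/
inductive InClosure {D : Type} (F : Set (Operation D)) {n : ℕ} (S : Set (Fin n → D)) :
    (Fin n → D) → Prop
  | basic (v : Fin n → D) (hv : v ∈ S) : InClosure F S v
  | app (f : Operation D) (hf : f ∈ F) (w : Fin f.arity → (Fin n → D))
      (hw : ∀ j, InClosure F S (w j)) : InClosure F S (f.onVectors w)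

/-! ### The Boolean operations and clones -/

/-- The threshold function `Th_k^{k+1}`: it has arity `k + 1` and is true if and only if at least
`k` of its arguments are. -/
def threshold (k : ℕ) : Operation Bool :=
  ⟨k + 1, k.succ_pos,
    fun x => decide (k ≤ (Finset.univ.filter (fun i : Fin (k + 1) => x i = true)).card)⟩

/-- The majority function of three arguments. -/
def maj : Operation Bool :=
  ⟨3, by norm_num, fun x => (x 0 && x 1) || (x 0 && x 2) || (x 1 && x 2)⟩

/-- `x ∧ (y ∨ z)` -/
def andOr : Operation Bool := ⟨3, by norm_num, fun x => x 0 && (x 1 || x 2)⟩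

/-- `x ∧ (y → z)` -/
def andImp : Operation Bool := ⟨3, by norm_num, fun x => x 0 && (!(x 1) || x 2)⟩

/-- `x + y + z` modulo two -/
def xor3 : Operation Bool := ⟨3, by norm_num, fun x => xor (xor (x 0) (x 1)) (x 2)⟩

/-- `S_10^k = ⟨Th_k^{k+1}, x ∧ (y ∨ z)⟩` -/
def S10 (k : ℕ) : Set (Operation Bool) := generatedClone {threshold k, andOr}

/-- `S_12^k = ⟨Th_k^{k+1}, x ∧ (y → z)⟩` -/
def S12 (k : ℕ) : Set (Operation Bool) := generatedClone {threshold k, andImp}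

/-- `D_1 = ⟨maj, x + y + z⟩` -/
def D1 : Set (Operation Bool) := generatedClone {maj, xor3}

/-! ### Random access machines -/

/-- Instructions of a random access machine. The machine has work registers `R[0], R[1], …`, each
holding a natural number, and read-only input registers `X[0], X[1], …`. -/
inductive Instr
  /-- `R[d] := c` -/
  | const (d c : ℕ)
  /-- `R[d] := R[a] + R[b]` -/
  | add (d a b : ℕ)
  /-- `R[d] := R[a] - R[b]`, or `0` if this is negative -/
  | sub (d a b : ℕ)
  /-- `R[d] := R[a] * R[b]` -/
  | mul (d a b : ℕ)
  /-- `R[d] := R[R[a]]` -/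
  | load (d a : ℕ)
  /-- `R[R[a]] := R[b]` -/
  | store (a b : ℕ)
  /-- `R[d] := X[R[a]]` -/
  | read (d a : ℕ)
  /-- jump to instruction `l` if `R[a] = 0` -/
  | jumpIfZero (a l : ℕ)

/-- A configuration: the index of the next instruction and the contents of the work registers. -/
structure Config where
  pc : ℕ
  reg : ℕ → ℕ

/-- The effect of one instruction, on input `x` (input registers beyond the end of `x` hold `0`). -/
def Instr.exec (x : List ℕ) (c : Config) : Instr → Config
  | .const d a => ⟨c.pc + 1, Function.update c.reg d a⟩
  | .add d a b => ⟨c.pc + 1, Function.update c.reg d (c.reg a + c.reg b)⟩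
  | .sub d a b => ⟨c.pc + 1, Function.update c.reg d (c.reg a - c.reg b)⟩
  | .mul d a b => ⟨c.pc + 1, Function.update c.reg d (c.reg a * c.reg b)⟩
  | .load d a => ⟨c.pc + 1, Function.update c.reg d (c.reg (c.reg a))⟩
  | .store a b => ⟨c.pc + 1, Function.update c.reg (c.reg a) (c.reg b)⟩
  | .read d a => ⟨c.pc + 1, Function.update c.reg d (x.getD (c.reg a) 0)⟩
  | .jumpIfZero a l => ⟨if c.reg a = 0 then l else c.pc + 1, c.reg⟩

/-- One step of the program `p`; a halted machine does not move. -/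
def step (p : List Instr) (x : List ℕ) (c : Config) : Config :=
  match p[c.pc]? with
  | some i => i.exec x c
  | none => c

/-- The configuration of the program `p` on input `x` after `s` steps. Initially all work registers
hold `0`. -/
def run (p : List Instr) (x : List ℕ) (s : ℕ) : Config :=
  (step p x)^[s] ⟨0, fun _ => 0⟩

/-- The machine has halted when there is no next instruction. -/
def Halted (p : List Instr) (c : Config) : Prop := p.length ≤ c.pc

/-- A decision problem: its instances, how an instance is presented in the input registers, and
the instances with answer yes. -/
structure DecisionProblem where
  Instance : Type
  input : Instance → List ℕ
  Yes : Set Instance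

/-- On the instance `I`, the program `p` halts after at most `t` steps with the correct answer in
`R[0]` (`1` for yes, `0` for no), and no register ever holds a number of more than `w` bits. -/
def DecidesWithin (P : DecisionProblem) (p : List Instr) (I : P.Instance) (t w : ℕ) : Prop :=
  ∃ s ≤ t, Halted p (run p (P.input I) s) ∧
    ((I ∈ P.Yes ∧ (run p (P.input I) s).reg 0 = 1) ∨
      (I ∉ P.Yes ∧ (run p (P.input I) s).reg 0 = 0)) ∧
    ∀ s' ≤ s, ∀ r, (run p (P.input I) s').reg r < 2 ^ w

/-- `P` is solvable in time `O(T)`: one program decides every instance `I` in at most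
`c * (T I + 1)` steps, where all numbers that occur have `O(log N)` bits, `N` bounding the number
of the input registers and the numbers they hold. (The `+ 1` only matters if `T I = 0`.) -/
def SolvableInTime (P : DecisionProblem) (T : P.Instance → ℕ) : Prop :=
  ∃ (p : List Instr) (c : ℕ), ∀ I : P.Instance,
    DecidesWithin P p I (c * (T I + 1))
      (c * Nat.size ((P.input I).length + (P.input I).sum + 1))

/-- The bit size of an input. -/
def bitSize (x : List ℕ) : ℕ := (x.map (fun a => Nat.size a + 1)).sum

/-- The class `P`: polynomially many steps, on numbers of polynomially many bits, in the bit size of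
the input (equivalently, polynomial time under the logarithmic cost criterion). -/
def InP (P : DecisionProblem) : Prop :=
  ∃ (p : List Instr) (q : Polynomial ℕ), ∀ I : P.Instance,
    DecidesWithin P p I (q.eval (bitSize (P.input I))) (q.eval (bitSize (P.input I)))

/-! ### The closure problem -/

/-- An instance of the closure problem: a vector `v` and a list `S` of `m` vectors, all of
size `n`. -/
structure ClosureInstance where
  n : ℕ
  m : ℕ
  v : Fin n → Bool
  S : Fin m → (Fin n → Bool)

/-- The instance as an input: `n`, `m`, the coordinates of `v`, and then the coordinates of the
vectors of `S`, one vector after the other. -/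
def ClosureInstance.input (I : ClosureInstance) : List ℕ :=
  [I.n, I.m] ++ (List.ofFn I.v).map Bool.toNat ++
    (List.ofFn (fun j => (List.ofFn (I.S j)).map Bool.toNat)).flatten

/-- `Closure_F`: does `v` belong to `Cl_F(S)`? -/
def closureProblem (F : Set (Operation Bool)) : DecisionProblem where
  Instance := ClosureInstance
  input := ClosureInstance.input
  Yes := {I | InClosure F (Set.range I.S) I.v}

end CloneClosure

/-!
By the Baker–Pixley theorem, a near-unanimity operation of arity at most `k + 1` in `F` makes
`Cl_F(S)` determined by its projections to `k` coordinates: `v` belongs to `Cl_F(S)` if and only if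
every `k`-tuple of coordinates of `v` belongs to the closure of the projection of `S`. Over a fixed
`k` there are only finitely many sets of Boolean vectors of size `k`, so both "insert a vector into
a set" and "is this vector in the closure of that set" are finite tables, which the program stores
in its memory. For each of the `n ^ k` tuples it scans the `m` vectors once, inserting their
projections one after the other by table lookup, and finally looks up the projection of `v`.
-/

namespace CloneClosure

/-! ### The Baker–Pixley theorem -/

section BakerPixley

variable {D : Type} {F : Set (Operation D)} {n k : ℕ} {S : Set (Fin n → D)} {v : Fin n → D}

/-- A near-unanimity operation: all but at most one argument being equal to `b` forces the
value `b`. In arity `1` or `2` this is only possible if `D` has at most one element. -/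
def Operation.IsNearUnanimity (f : Operation D) : Prop :=
  ∀ (x : Fin f.arity → D) (b : D) (i₀ : Fin f.arity), (∀ i, i ≠ i₀ → x i = b) → f.toFun x = b

theorem Operation.IsNearUnanimity.one_lt_arity [Nontrivial D] {f : Operation D}
    (hf : f.IsNearUnanimity) : 1 < f.arity := by
  by_contra! h
  have : Subsingleton (Fin f.arity) := Fin.subsingleton_iff_le_one.mpr h
  obtain ⟨a, b, hab⟩ := exists_pair_ne D
  have eq_any (b : D) : f.toFun (fun _ => a) = b :=
    hf _ b ⟨0, f.arity_pos⟩ fun i hi => absurd (Subsingleton.elim i _) hi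
  exact hab ((eq_any a).symm.trans (eq_any b))

theorem InClosure.comp_right (e : Fin k → Fin n) (h : InClosure F S v) :
    InClosure F ((· ∘ e) '' S) (v ∘ e) := by
  induction h with
  | basic v hv => exact .basic _ ⟨v, hv, rfl⟩
  | app f hf w _ ih => exact .app f hf (fun j => w j ∘ e) ih

theorem InClosure.exists_comp_right_eq {e : Fin k → Fin n} {u : Fin k → D}
    (h : InClosure F ((· ∘ e) '' S) u) : ∃ w, InClosure F S w ∧ w ∘ e = u := by
  induction h with
  | basic _ hu =>
    obtain ⟨w, hw, rfl⟩ := hu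
    exact ⟨w, .basic w hw, rfl⟩
  | app f hf _ _ ih =>
    choose g hg hgw using ih
    refine ⟨f.onVectors g, .app f hf g hg, funext fun i => ?_⟩
    exact congrArg f.toFun (funext fun j => congrFun (hgw j) i)

theorem not_inClosure_empty : ¬ InClosure F ∅ v := by
  intro h
  induction h with
  | basic _ hv => exact hv
  | app f _ _ _ ih => exact ih ⟨0, f.arity_pos⟩

theorem exists_fin_map_of_card_le {J : Finset (Fin n)} (hJ : J.Nonempty) (hcard : J.card ≤ k) :
    ∃ e : Fin k → Fin n, ∀ j ∈ J, ∃ i, e i = j := by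
  obtain ⟨j₀, -⟩ := hJ
  obtain ⟨g⟩ : Nonempty (J ↪ Fin k) := Function.Embedding.nonempty_of_card_le (by simpa)
  exact ⟨Function.extend g (↑) fun _ => j₀, fun j hj => ⟨g ⟨j, hj⟩, g.injective.extend_apply ..⟩⟩

/-- If each coordinate of `J` is wrong in at most one argument, near-unanimity repairs them all. -/
theorem Operation.IsNearUnanimity.onVectors_eq {f : Operation D} (hf : f.IsNearUnanimity)
    {J : Finset (Fin n)} {a : Fin f.arity → Fin n} (ha : a.Injective)
    {w : Fin f.arity → (Fin n → D)} (hw : ∀ i, ∀ j ∈ J.erase (a i), w i j = v j) :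
    ∀ j ∈ J, f.onVectors w j = v j := by
  intro j hj
  by_cases hja : ∃ i, a i = j
  · obtain ⟨i₀, rfl⟩ := hja
    exact hf _ _ i₀ fun i hi => hw i _ (Finset.mem_erase.mpr ⟨(ha.ne hi).symm, hj⟩)
  · exact hf _ _ ⟨0, f.arity_pos⟩ fun i _ =>
      hw i _ (Finset.mem_erase.mpr ⟨fun h => hja ⟨i, h.symm⟩, hj⟩)

theorem exists_inClosure_eqOn {f : Operation D} (hfF : f ∈ F) (hf : f.IsNearUnanimity)
    (hk : f.arity ≤ k + 1) (hS : S.Nonempty)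
    (h : ∀ e : Fin k → Fin n, InClosure F ((· ∘ e) '' S) (v ∘ e)) (J : Finset (Fin n)) :
    ∃ w, InClosure F S w ∧ ∀ j ∈ J, w j = v j := by
  induction J using Finset.strongInduction with
  | H J ih =>
    rcases J.eq_empty_or_nonempty with rfl | hJ
    · obtain ⟨w, hw⟩ := hS
      exact ⟨w, .basic w hw, by simp⟩
    rcases le_or_gt J.card k with hcard | hcard
    · obtain ⟨e, he⟩ := exists_fin_map_of_card_le hJ hcard
      obtain ⟨w, hw, hwe⟩ := (h e).exists_comp_right_eq
      refine ⟨w, hw, fun j hj => ?_⟩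
      obtain ⟨i, rfl⟩ := he j hj
      exact congrFun hwe i
    · obtain ⟨a⟩ : Nonempty (Fin f.arity ↪ J) :=
        Function.Embedding.nonempty_of_card_le (by simp; omega)
      choose w hw hwv using fun i => ih _ (Finset.erase_ssubset (a i).2)
      exact ⟨f.onVectors w, .app f hfF w hw,
        hf.onVectors_eq (Subtype.val_injective.comp a.injective) hwv⟩

theorem inClosure_iff_forall_comp {f : Operation D} (hfF : f ∈ F) (hf : f.IsNearUnanimity)
    (hk : f.arity ≤ k + 1) (hS : S.Nonempty) :
    InClosure F S v ↔ ∀ e : Fin k → Fin n, InClosure F ((· ∘ e) '' S) (v ∘ e) := by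
  refine ⟨fun h e => h.comp_right e, fun h => ?_⟩
  obtain ⟨w, hw, hwv⟩ := exists_inClosure_eqOn hfF hf hk hS h Finset.univ
  rwa [← funext fun j => hwv j (Finset.mem_univ j)]

end BakerPixley

theorem isNearUnanimity_threshold {k : ℕ} (hk : 2 ≤ k) : (threshold k).IsNearUnanimity := by
  change ∀ (x : Fin (k + 1) → Bool) (b : Bool) (i₀ : Fin (k + 1)), (∀ i, i ≠ i₀ → x i = b) →
    decide (k ≤ (Finset.univ.filter fun i => x i = true).card) = b
  intro x b i₀ h
  cases b with
  | true =>
    have hsub : Finset.univ.erase i₀ ⊆ Finset.univ.filter fun i => x i = true := fun i hi => by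
      simpa using h i (Finset.ne_of_mem_erase hi)
    have hcard : (Finset.univ.erase i₀).card = k := by simp
    exact decide_eq_true (hcard.symm.le.trans (Finset.card_le_card hsub))
  | false =>
    have hsub : (Finset.univ.filter fun i => x i = true) ⊆ {i₀} := fun i hi => by
      by_contra hne
      simp_all
    have hcard : _ ≤ 1 := Finset.card_le_card hsub
    exact decide_eq_false fun hk' => absurd (hk'.trans hcard) (by omega)

theorem isNearUnanimity_maj : maj.IsNearUnanimity := by
  change ∀ (x : Fin 3 → Bool) (b : Bool) (i₀ : Fin 3), (∀ i, i ≠ i₀ → x i = b) →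
    ((x 0 && x 1) || (x 0 && x 2) || (x 1 && x 2)) = b
  decide

/-! ### Verified program fragments -/

/-- The machine gets from `c` to `c'` in at most `t` steps, all registers staying below `W`. -/
def Reach (p : List Instr) (x : List ℕ) (W t : ℕ) (c c' : Config) : Prop :=
  ∃ u ≤ t, (step p x)^[u] c = c' ∧ ∀ u' ≤ u, ∀ r, ((step p x)^[u'] c).reg r < W

namespace Reach

variable {p : List Instr} {x : List ℕ} {W t t' o : ℕ} {c c' c'' : Config} {s : ℕ → ℕ}

theorem refl (hc : ∀ r, c.reg r < W) : Reach p x W 0 c c :=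
  ⟨0, le_rfl, rfl, fun _ hu => by rwa [Nat.le_zero.mp hu]⟩

theorem reg_lt (h : Reach p x W t c c') : ∀ r, c'.reg r < W := by
  obtain ⟨u, -, rfl, hu⟩ := h
  exact hu u le_rfl

theorem mono (h : Reach p x W t c c') (ht : t ≤ t') : Reach p x W t' c c' :=
  h.imp fun _ hu => ⟨hu.1.trans ht, hu.2⟩

theorem trans (h : Reach p x W t c c') (h' : Reach p x W t' c' c'') :
    Reach p x W (t + t') c c'' := by
  obtain ⟨u, hu, rfl, hlt⟩ := h
  obtain ⟨u', hu', rfl, hlt'⟩ := h'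
  refine ⟨u' + u, by omega, Function.iterate_add_apply .., fun i hi r => ?_⟩
  rcases le_total i u with hiu | hui
  · exact hlt i hiu r
  · obtain ⟨i, rfl⟩ := Nat.exists_eq_add_of_le' hui
    rw [Function.iterate_add_apply]
    exact hlt' i (by omega) r

theorem single {i : Instr} (hi : p[c.pc]? = some i) (hc : ∀ r, c.reg r < W)
    (hc' : ∀ r, (i.exec x c).reg r < W) : Reach p x W 1 c (i.exec x c) := by
  have hstep : step p x c = i.exec x c := by simp [step, hi]
  refine ⟨1, le_rfl, hstep, fun u hu => ?_⟩
  interval_cases u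
  · exact hc
  · simpa [hstep] using hc'

theorem jumpIfZero {a l : ℕ} (hi : p[o]? = some (.jumpIfZero a l)) (hs : ∀ r, s r < W) :
    Reach p x W 1 ⟨o, s⟩ ⟨if s a = 0 then l else o + 1, s⟩ :=
  single (c := ⟨o, s⟩) hi hs hs

end Reach

/-- The list `L` occurs in `p` at position `o`. -/
def Located (p : List Instr) (o : ℕ) (L : List Instr) : Prop :=
  ∃ l r, l.length = o ∧ p = l ++ L ++ r

namespace Located

variable {p L L' : List Instr} {o : ℕ}

theorem left : Located p o (L ++ L') → Located p o L := by
  rintro ⟨l, r, hl, rfl⟩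
  exact ⟨l, L' ++ r, hl, by simp⟩

theorem right : Located p o (L ++ L') → Located p (o + L.length) L' := by
  rintro ⟨l, r, rfl, rfl⟩
  exact ⟨l ++ L, r, by simp, by simp⟩

theorem getElem? {i : Instr} : Located p o (i :: L) → p[o]? = some i := by
  rintro ⟨l, r, rfl, rfl⟩
  simp

end Located

/-- A program fragment, as a function of the position at which it is placed (jump targets are
absolute). -/
abbrev Code : Type := ℕ → List Instr

-- The two registers holding the constants `1` and `0` that loops rely on.
local notation "rOne" => 3
local notation "rZero" => 4

namespace Code

/-- A sequence of instructions without jumps. -/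
def block (L : List Instr) : Code := fun _ => L

/-- Sequential composition. -/
def seq (b b' : Code) : Code := fun o => b o ++ b' (o + (b o).length)

/-- Skip `b` if the register `a` is zero. -/
def unlessZero (a : ℕ) (b : Code) : Code := fun o =>
  [.jumpIfZero a (o + 1 + (b (o + 1)).length)] ++ b (o + 1)

/-- As long as the register `c` is nonzero, decrement it and run `b`. The unconditional jump back
is a jump conditioned on the constant register `rZero`. -/
def countdown (c : ℕ) (b : Code) : Code := fun o =>
  let body := block [.sub c c rOne] |>.seq b
  [.jumpIfZero c (o + 1 + (body (o + 1)).length + 1)] ++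
    (body (o + 1) ++ [.jumpIfZero rZero o])

end Code

local infixr:60 " ;; " => Code.seq

/-- A total-correctness triple: started with registers `s`, all below `W`, the fragment `b` runs to
its end within `t` steps, the registers stay below `W` and finally satisfy `Q`. -/
def Exec (x : List ℕ) (W : ℕ) (b : Code) (t : ℕ) (s : ℕ → ℕ) (Q : (ℕ → ℕ) → Prop) : Prop :=
  (∀ r, s r < W) → ∀ p o, Located p o (b o) →
    ∃ s', Q s' ∧ Reach p x W t ⟨o, s⟩ ⟨o + (b o).length, s'⟩

namespace Exec

open Code

variable {x : List ℕ} {W t t' : ℕ} {s : ℕ → ℕ} {Q R : (ℕ → ℕ) → Prop} {b b' : Code}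
  {L : List Instr}

theorem mono (h : Exec x W b t s Q) (ht : t ≤ t') (hQ : ∀ s', Q s' → R s') :
    Exec x W b t' s R := by
  intro hs p o hl
  obtain ⟨s', hs', hreach⟩ := h hs p o hl
  exact ⟨s', hQ s' hs', hreach.mono ht⟩

theorem seq (h : Exec x W b t s Q) (h' : ∀ s', Q s' → Exec x W b' t' s' R) :
    Exec x W (b ;; b') (t + t') s R := by
  intro hs p o hl
  obtain ⟨s', hs', hreach⟩ := h hs p o hl.left
  obtain ⟨s'', hs'', hreach'⟩ := h' s' hs' hreach.reg_lt p _ hl.right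
  refine ⟨s'', hs'', ?_⟩
  simpa [Code.seq, Nat.add_assoc] using hreach.trans hreach'

theorem nil (hQ : Q s) : Exec x W (block []) 0 s Q :=
  fun hs _ _ _ => ⟨s, hQ, Reach.refl hs⟩

theorem cons {i : Instr} {d a : ℕ}
    (hi : ∀ pc, i.exec x ⟨pc, s⟩ = ⟨pc + 1, Function.update s d a⟩)
    (ha : (∀ r, s r < W) → a < W) (h : Exec x W (block L) t (Function.update s d a) Q) :
    Exec x W (block (i :: L)) (t + 1) s Q := by
  intro hs p o hl
  have hs' : ∀ r, Function.update s d a r < W := fun r => by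
    rcases eq_or_ne r d with rfl | hr
    · simpa using ha hs
    · simpa [hr] using hs r
  obtain ⟨s', hQ, hreach⟩ := h hs' p (o + 1) (Located.right (L := [i]) hl)
  have hfirst : Reach p x W 1 ⟨o, s⟩ (i.exec x ⟨o, s⟩) :=
    .single (Located.getElem? hl) hs (by simpa only [hi] using hs')
  rw [hi] at hfirst
  refine ⟨s', hQ, ?_⟩
  simpa [block, Nat.add_comm, Nat.add_left_comm] using hfirst.trans hreach

theorem const {d a : ℕ} (ha : a < W) (h : Exec x W (block L) t (Function.update s d a) Q) :
    Exec x W (block (.const d a :: L)) (t + 1) s Q :=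
  cons (fun _ => rfl) (fun _ => ha) h

theorem add {d a a' : ℕ} (ha : s a + s a' < W)
    (h : Exec x W (block L) t (Function.update s d (s a + s a')) Q) :
    Exec x W (block (.add d a a' :: L)) (t + 1) s Q :=
  cons (fun _ => rfl) (fun _ => ha) h

theorem sub {d a a' : ℕ} (h : Exec x W (block L) t (Function.update s d (s a - s a')) Q) :
    Exec x W (block (.sub d a a' :: L)) (t + 1) s Q :=
  cons (fun _ => rfl) (fun hs => (Nat.sub_le ..).trans_lt (hs a)) h

theorem mul {d a a' : ℕ} (ha : s a * s a' < W)
    (h : Exec x W (block L) t (Function.update s d (s a * s a')) Q) :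
    Exec x W (block (.mul d a a' :: L)) (t + 1) s Q :=
  cons (fun _ => rfl) (fun _ => ha) h

theorem load {d a : ℕ} (h : Exec x W (block L) t (Function.update s d (s (s a))) Q) :
    Exec x W (block (.load d a :: L)) (t + 1) s Q :=
  cons (fun _ => rfl) (fun hs => hs _) h

theorem read {d a : ℕ} (ha : x.getD (s a) 0 < W)
    (h : Exec x W (block L) t (Function.update s d (x.getD (s a) 0)) Q) :
    Exec x W (block (.read d a :: L)) (t + 1) s Q :=
  cons (fun _ => rfl) (fun _ => ha) h

theorem unlessZero {a : ℕ} (hzero : s a = 0 → Q s) (hne : s a ≠ 0 → Exec x W b t s Q) :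
    Exec x W (.unlessZero a b) (t + 1) s Q := by
  intro hs p o hl
  have hjump := Reach.jumpIfZero (x := x) (Located.getElem? hl) hs
  have hlen : o + (Code.unlessZero a b o).length = o + 1 + (b (o + 1)).length := by
    simp only [Code.unlessZero, List.length_append, List.length_singleton, Nat.add_assoc]
  rw [hlen]
  by_cases ha : s a = 0
  · rw [if_pos ha] at hjump
    exact ⟨s, hzero ha, hjump.mono (by omega)⟩
  · rw [if_neg ha] at hjump
    obtain ⟨s', hQ, hreach⟩ := hne ha hs p (o + 1) (Located.right (L := [_]) hl)
    exact ⟨s', hQ, (hjump.trans hreach).mono (by omega)⟩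

theorem countdown {c N : ℕ} {Inv : ℕ → (ℕ → ℕ) → Prop}
    (hInv : ∀ j s, Inv j s → s c = j ∧ s rOne = 1 ∧ s rZero = 0)
    (hbody : ∀ j < N, ∀ s, Inv (j + 1) s → Exec x W b t (Function.update s c j) (Inv j))
    (hs : Inv N s) : Exec x W (.countdown c b) (N * (t + 3) + 1) s (Inv 0) := by
  induction N generalizing s with
  | zero =>
    intro hlt p o hl
    have hjump := Reach.jumpIfZero (x := x) (Located.getElem? hl) hlt
    rw [if_pos (hInv _ _ hs).1] at hjump
    have hlen : o + (Code.countdown c b o).length =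
        o + 1 + ((block [.sub c c rOne]).seq b (o + 1)).length + 1 := by
      simp only [Code.countdown, List.length_append, List.length_singleton, Nat.add_assoc]
    rw [hlen]
    exact ⟨s, hs, hjump.mono (by omega)⟩
  | succ N ih =>
    intro hlt p o hl
    obtain ⟨hc, hone, -⟩ := hInv _ _ hs
    have hround : Exec x W (block [.sub c c rOne] ;; b) (1 + t) s (Inv N) := by
      refine Exec.seq (sub (nil rfl)) fun s' hs' => ?_
      simpa [← hs', hc, hone] using hbody N (by omega) s hs
    have henter := Reach.jumpIfZero (x := x) (Located.getElem? hl) hlt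
    rw [if_neg (by omega)] at henter
    have hl' := Located.right (L := [_]) hl
    obtain ⟨s₁, hs₁, hreach⟩ := hround hlt p (o + 1) hl'.left
    have hback := Reach.jumpIfZero (x := x) (Located.getElem? hl'.right) hreach.reg_lt
    rw [if_pos (hInv _ _ hs₁).2.2] at hback
    obtain ⟨s₂, hs₂, hrest⟩ := ih (fun j hj => hbody j (by omega)) hs₁ hback.reg_lt p o hl
    exact ⟨s₂, hs₂, (((henter.trans hreach).trans hback).trans hrest).mono (by linarith)⟩

end Exec

theorem decidesWithin_of_exec {P : DecisionProblem} {I : P.Instance} {b : Code} {t w : ℕ}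
    (h : Exec (P.input I) (2 ^ w) b t (fun _ => 0) fun s =>
      (I ∈ P.Yes ∧ s 0 = 1) ∨ (I ∉ P.Yes ∧ s 0 = 0)) :
    DecidesWithin P (b 0) I t w := by
  obtain ⟨s, hs, u, hu, hrun, hlt⟩ := h (fun _ => by positivity) (b 0) 0 ⟨[], [], rfl, by simp⟩
  refine ⟨u, hu, ?_, ?_, hlt⟩
  · simp [Halted, run, hrun]
  · simpa only [run, hrun] using hs

/-! ### Lookup tables -/

/-- The number obtained from `a` by appending the bits of `u` to its binary representation. -/
def appendBits : ∀ {k : ℕ}, ℕ → (Fin k → Bool) → ℕ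
  | 0, a, _ => a
  | k + 1, a, u => Nat.bit (u (Fin.last k)) (appendBits a fun i => u i.castSucc)

theorem appendBits_lt {k : ℕ} (a : ℕ) (u : Fin k → Bool) : appendBits a u < (a + 1) * 2 ^ k := by
  induction k with
  | zero => simp [appendBits]
  | succ k ih =>
    have hbit := Bool.toNat_le (u (Fin.last k))
    have hlt := ih fun i => u i.castSucc
    rw [appendBits, Nat.bit_val, pow_succ]
    lia

theorem appendBits_injective {k : ℕ} :
    (fun p : ℕ × (Fin k → Bool) => appendBits p.1 p.2).Injective := by
  induction k with
  | zero => rintro ⟨a, u⟩ ⟨a', u'⟩ h; exact Prod.ext h (Subsingleton.elim ..)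
  | succ k ih =>
    rintro ⟨a, u⟩ ⟨a', u'⟩ h
    simp only [appendBits, Nat.bit_val] at h
    have hlast : u (Fin.last k) = u' (Fin.last k) := by
      cases hu : u (Fin.last k) <;> cases hu' : u' (Fin.last k) <;>
        simp only [hu, hu', Bool.toNat_true, Bool.toNat_false] at h ⊢ <;> omega
    have hinit := @ih (a, fun i => u i.castSucc) (a', fun i => u' i.castSucc) (by
      rw [hlast] at h
      exact Nat.eq_of_mul_eq_mul_left two_pos (Nat.add_right_cancel h))
    rw [Prod.mk.injEq] at hinit ⊢
    exact ⟨hinit.1, funext (Fin.lastCases hlast (congrFun hinit.2))⟩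

/-- The number that represents a set of vectors in a register, in an arbitrary numbering of the
subsets of `{0,1}^k`. -/
noncomputable def setCode {k : ℕ} (A : Set (Fin k → Bool)) : ℕ :=
  Fintype.equivFin (Set (Fin k → Bool)) A

/-- The size of a table indexed by a set of vectors in `{0,1}^k` and one more such vector. -/
noncomputable def tableSize (k : ℕ) : ℕ := Fintype.card (Set (Fin k → Bool)) * 2 ^ k

section Tables

variable {k : ℕ} {f : Set (Fin k → Bool) → (Fin k → Bool) → ℕ}

theorem setCode_succ_mul_le (A : Set (Fin k → Bool)) : (setCode A + 1) * 2 ^ k ≤ tableSize k :=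
  Nat.mul_le_mul_right _ (Fintype.equivFin _ A).isLt

theorem appendBits_setCode_lt (A : Set (Fin k → Bool)) (u : Fin k → Bool) :
    appendBits (setCode A) u < tableSize k :=
  (appendBits_lt _ u).trans_le (setCode_succ_mul_le A)

theorem setCode_lt_tableSize (A : Set (Fin k → Bool)) : setCode A < tableSize k :=
  (Nat.le_mul_of_pos_right _ (by positivity)).trans (setCode_succ_mul_le A)

/-- The entries of the table of `f`, as a function of the address. -/
noncomputable def tableEntry (f : Set (Fin k → Bool) → (Fin k → Bool) → ℕ) : ℕ → ℕ :=
  Function.extend (fun p => appendBits (setCode p.1) p.2) (Function.uncurry f) 0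

theorem tableEntry_appendBits (A : Set (Fin k → Bool)) (u : Fin k → Bool) :
    tableEntry f (appendBits (setCode A) u) = f A u := by
  have hinj : (fun p : Set (Fin k → Bool) × (Fin k → Bool) =>
      appendBits (setCode p.1) p.2).Injective :=
    appendBits_injective.comp <| Function.Injective.prodMap
      (Fin.val_injective.comp (Equiv.injective _)) Function.injective_id
  exact hinj.extend_apply _ _ (A, u)

theorem tableEntry_lt {W : ℕ} (hW : 0 < W) (hf : ∀ A u, f A u < W) (i : ℕ) :
    tableEntry f i < W := by
  unfold tableEntry
  rw [Function.extend_def]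
  split_ifs
  · exact hf ..
  · exact hW

end Tables

/-- `1` for true and `0` for false, as in the answer of a machine. -/
noncomputable def truthValue (P : Prop) : ℕ := open Classical in if P then 1 else 0

theorem truthValue_mul (P Q : Prop) : truthValue P * truthValue Q = truthValue (P ∧ Q) := by
  by_cases hP : P <;> by_cases hQ : Q <;> simp [truthValue, hP, hQ]

theorem truthValue_le_one (P : Prop) : truthValue P ≤ 1 := by
  unfold truthValue
  split_ifs <;> simp

namespace Code

/-- Store the constants `f 0, …, f (M - 1)` from the register `a` on. -/
def writeTable (a : ℕ) (f : ℕ → ℕ) : ℕ → Code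
  | 0 => block []
  | M + 1 => writeTable a f M ;; block [.const (a + M) (f M)]

end Code

theorem exec_writeTable {x : List ℕ} {W a M : ℕ} {f : ℕ → ℕ} {s : ℕ → ℕ}
    (hf : ∀ i < M, f i < W) :
    Exec x W (.writeTable a f M) M s fun s' =>
      (∀ i < M, s' (a + i) = f i) ∧ ∀ r, r < a ∨ a + M ≤ r → s' r = s r := by
  induction M with
  | zero => exact .nil ⟨by simp, fun _ _ => rfl⟩
  | succ M ih =>
    refine .seq (ih fun i hi => hf i (by omega)) fun s' ⟨htable, hframe⟩ =>
      .const (hf M (by omega)) (.nil ⟨fun i hi => ?_, fun r hr => ?_⟩)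
    · rcases Nat.lt_succ_iff_lt_or_eq.mp hi with hi | rfl
      · rw [Function.update_of_ne (by omega), htable i hi]
      · exact Function.update_self ..
    · rw [Function.update_of_ne (by omega), hframe r (by omega)]

/-! ### The program -/

/- Register layout: `rAnswer` is `0`, the output register; `rRow` is the input address of the
coordinates of the current vector; `rState` is the number of the set of the projections read so far;
`rColumn + i` is the `i`-th coordinate of the current tuple. -/
local notation "rAnswer" => 0
local notation "rN" => 1
local notation "rM" => 2
local notation "rRow" => 5
local notation "rLeft" => 6
local notation "rState" => 7
local notation "rTemp" => 8
local notation "rColumn" => 9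

/-- The address of the table of the insertion of a vector into a set of vectors. -/
def insertBase (k : ℕ) : ℕ := rColumn + k

/-- The address of the table of the closure problem for vectors of size `k`. -/
noncomputable def closureBase (k : ℕ) : ℕ := insertBase k + tableSize k

/-- The number of registers in use. -/
noncomputable def memorySize (k : ℕ) : ℕ := closureBase k + tableSize k

namespace Code

/-- Append the bits of the current vector at the current tuple of coordinates to `rState`. -/
def pushBits : ℕ → Code
  | 0 => block []
  | k + 1 => pushBits k ;; block [.add rTemp rRow (rColumn + k), .read rTemp rTemp,
      .add rState rState rState, .add rState rState rTemp]

/-- Replace the set in `rState` by the entry of a table for this set and the projection of the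
current vector to the current tuple of coordinates. -/
def lookup (k base : ℕ) : Code :=
  pushBits k ;; block [.const rTemp base, .add rTemp rTemp rState, .load rState rTemp]

/-- Go to the vector in front of the current one, and look it up in a table. -/
def lookupPrevious (k base : ℕ) : Code := block [.sub rRow rRow rN] ;; lookup k base

end Code

/-- The table of `f` is stored in the registers `s` from the address `base` on. -/
def StoresTable {k : ℕ} (s : ℕ → ℕ) (base : ℕ) (f : Set (Fin k → Bool) → (Fin k → Bool) → ℕ) :
    Prop :=
  ∀ A u, s (base + appendBits (setCode A) u) = f A u

section Lookup

variable {x : List ℕ} {W k : ℕ} {s : ℕ → ℕ} {u : Fin k → Bool}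

theorem exec_pushBits (hx : ∀ i : Fin k, x[s rRow + s (rColumn + i)]? = some (u i).toNat)
    (hlen : x.length ≤ W) (hW : (s rState + 1) * 2 ^ k ≤ W) :
    Exec x W (.pushBits k) (4 * k) s fun s' =>
      s' rState = appendBits (s rState) u ∧ ∀ r, r ≠ rState → r ≠ rTemp → s' r = s r := by
  induction k with
  | zero => exact .nil ⟨rfl, fun _ _ _ => rfl⟩
  | succ k ih =>
    rw [pow_succ, ← mul_assoc] at hW
    refine .seq (ih (fun i => hx i.castSucc) (by omega)) fun s' ⟨hstate, hframe⟩ => ?_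
    have hlt := appendBits_lt (s rState) fun i => u i.castSucc
    have hbit := Bool.toNat_le (u (Fin.last k))
    have hread := hx (Fin.last k)
    obtain ⟨haddr, -⟩ := List.getElem?_eq_some_iff.mp hread
    have hrow : s' rRow = s rRow := hframe _ (by decide) (by decide)
    have hcol : s' (rColumn + k) = s (rColumn + k) := hframe _ (by omega) (by omega)
    rw [Fin.val_last] at hread haddr
    have hgetD : x.getD (s rRow + s (rColumn + k)) 0 = (u (Fin.last k)).toNat := by
      rw [List.getD_eq_getElem?_getD, hread, Option.getD_some]
    refine .add ?_ (.read ?_ (.add ?_ (.add ?_ (.nil ⟨?_, fun r hs ht => ?_⟩))))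
    all_goals simp only [Function.update_apply, Nat.reduceEqDiff, reduceIte, hrow, hcol, hstate,
      hgetD]
    · omega
    · omega
    · omega
    · omega
    · rw [appendBits, Nat.bit_val, two_mul]
    · simp only [if_neg hs, if_neg ht, hframe r hs ht]

theorem exec_lookup {base : ℕ} {A : Set (Fin k → Bool)}
    {f : Set (Fin k → Bool) → (Fin k → Bool) → ℕ}
    (hx : ∀ i : Fin k, x[s rRow + s (rColumn + i)]? = some (u i).toNat) (hlen : x.length ≤ W)
    (hA : s rState = setCode A) (hf : StoresTable s base f) (hbase : rColumn ≤ base)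
    (hW : base + tableSize k ≤ W) :
    Exec x W (.lookup k base) (4 * k + 3) s fun s' =>
      s' rState = f A u ∧ ∀ r, r ≠ rState → r ≠ rTemp → s' r = s r := by
  have hlt := appendBits_setCode_lt A u
  have hpush : (s rState + 1) * 2 ^ k ≤ W := by
    rw [hA]
    exact (setCode_succ_mul_le A).trans (by omega)
  refine .seq (exec_pushBits hx hlen hpush) fun s' ⟨hstate, hframe⟩ => ?_
  rw [hA] at hstate
  have hentry : s' (base + appendBits (setCode A) u) = f A u :=
    (hframe _ (by omega) (by omega)).trans (hf A u)
  refine .const (by omega) (.add ?_ (.load (.nil ⟨?_, fun r hs ht => ?_⟩)))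
  · simp only [Function.update_apply, Nat.reduceEqDiff, reduceIte, hstate]
    omega
  · simp only [Function.update_apply, Nat.reduceEqDiff, reduceIte, hstate]
    rwa [if_neg (by omega), if_neg (by omega)]
  · simp only [Function.update_apply, if_neg hs, if_neg ht, hframe r hs ht]

end Lookup

/-- The registers `s'` agree with `s` on `n`, `m` and the constants, on the tables and on all
columns from `l` on. -/
def Keeps (l : ℕ) (s s' : ℕ → ℕ) : Prop :=
  ∀ r, r ∈ Set.Icc rN rZero ∨ rColumn + l ≤ r → s' r = s r

namespace Keeps

variable {l l' : ℕ} {s s' s'' : ℕ → ℕ}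

theorem refl : Keeps l s s := fun _ _ => rfl

theorem trans (h : Keeps l s s') (h' : Keeps l s' s'') : Keeps l s s'' :=
  fun r hr => (h' r hr).trans (h r hr)

theorem mono (h : Keeps l s s') (hl : l ≤ l') : Keeps l' s s' :=
  fun r hr => h r (hr.imp_right fun _ => by omega)

theorem update (h : Keeps l s s') {r a : ℕ} (hr : rRow ≤ r) (hl : r < rColumn + l) :
    Keeps l s (Function.update s' r a) := fun r' hr' => by
  rw [Function.update_of_ne (by rw [Set.mem_Icc] at hr'; omega), h r' hr']

end Keeps

theorem StoresTable.of_keeps {k l base : ℕ} {s s' : ℕ → ℕ}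
    {f : Set (Fin k → Bool) → (Fin k → Bool) → ℕ} (h : StoresTable s base f) (hs : Keeps l s s')
    (hbase : rColumn + l ≤ base) : StoresTable s' base f := fun A u =>
  (hs _ (.inr (hbase.trans (Nat.le_add_right ..)))).trans (h A u)

namespace ClosureInstance

variable {I : ClosureInstance}

theorem input_eq : I.input = ([I.n, I.m] ++ List.ofFn fun i => (I.v i).toNat) ++
    List.ofFn fun p : Fin (I.m * I.n) => (I.S p.divNat p.modNat).toNat := by
  have hmk (j : Fin I.m) (i : Fin I.n) (h : j * I.n + i < I.m * I.n) :
      (⟨j * I.n + i, h⟩ : Fin (I.m * I.n)) = Fin.mkDivMod j i := by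
    simp [Fin.ext_iff, Nat.mul_comm]
  simp only [input, List.map_ofFn, Function.comp_def, List.ofFn_mul, hmk, Fin.divNat_mkDivMod,
    Fin.modNat_mkDivMod]

theorem length_input : I.input.length = 2 + I.n + I.m * I.n := by
  simp only [input_eq, List.length_append, List.length_cons, List.length_nil, List.length_ofFn]

theorem n_lt_length_input : I.n < I.input.length := by
  rw [length_input]
  omega

theorem m_le_sum_input : I.m ≤ I.input.sum := by
  simp only [input_eq, List.cons_append, List.nil_append, List.sum_cons]
  omega

theorem getElem?_input_v (i : Fin I.n) : I.input[2 + (i : ℕ)]? = some (I.v i).toNat := by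
  simp [input_eq, List.getElem?_append, Nat.add_comm 2]

theorem getElem?_input_S (j : Fin I.m) (i : Fin I.n) :
    I.input[2 + I.n + I.n * j + i]? = some (I.S j i).toNat := by
  have hlen : ([I.n, I.m] ++ List.ofFn fun i => (I.v i).toNat).length = 2 + I.n := by
    simp only [List.length_append, List.length_cons, List.length_nil, List.length_ofFn]
  have hindex : 2 + I.n + I.n * j + i - (2 + I.n) = Fin.mkDivMod j i := by
    rw [Fin.coe_mkDivMod]
    omega
  rw [input_eq, List.getElem?_append_right (by omega), hlen, hindex,
    List.getElem?_ofFn, dif_pos (Fin.isLt _), Fin.divNat_mkDivMod, Fin.modNat_mkDivMod]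

end ClosureInstance

namespace Code

/-- Prepare a scan of the vectors of `S` from the last one to the first one. -/
noncomputable def startScan (k : ℕ) : Code :=
  block [.const rState (setCode (∅ : Set (Fin k → Bool))), .mul rRow rN rM, .add rRow rRow rN,
    .const rTemp 2, .add rRow rRow rTemp, .add rLeft rM rZero]

/-- Multiply `rAnswer` by the answer to the closure problem for the projections to the current tuple
of coordinates. The last lookup is that of `v`, which precedes the vectors of `S` in the input. -/
noncomputable def testTuple (k : ℕ) : Code :=
  startScan k ;; countdown rLeft (lookupPrevious k (insertBase k)) ;;
    lookupPrevious k (closureBase k) ;; block [.mul rAnswer rAnswer rState]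

/-- Run `b` for all values less than `n` of the first `l` columns. -/
def forTuples (b : Code) : ℕ → Code
  | 0 => b
  | l + 1 => block [.add (rColumn + l) rN rZero] ;; countdown (rColumn + l) (forTuples b l)

end Code

/-- The registers hold the parameters of the instance, the constants and the two tables. -/
structure Ready (F : Set (Operation Bool)) (k : ℕ) (I : ClosureInstance) (s : ℕ → ℕ) : Prop where
  n_eq : s rN = I.n
  m_eq : s rM = I.m
  one_eq : s rOne = 1
  zero_eq : s rZero = 0
  insert_table : StoresTable (k := k) s (insertBase k) fun A u => setCode (insert u A)
  closure_table : StoresTable (k := k) s (closureBase k) fun A u => truthValue (InClosure F A u)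

theorem Ready.of_keeps {F : Set (Operation Bool)} {k : ℕ} {I : ClosureInstance} {s s' : ℕ → ℕ}
    (h : Ready F k I s) (hs : Keeps k s s') : Ready F k I s' where
  n_eq := (hs _ (by simp)).trans h.n_eq
  m_eq := (hs _ (by simp)).trans h.m_eq
  one_eq := (hs _ (by simp)).trans h.one_eq
  zero_eq := (hs _ (by simp)).trans h.zero_eq
  insert_table := h.insert_table.of_keeps hs le_rfl
  closure_table := h.closure_table.of_keeps hs (Nat.le_add_right ..)

/-- The projections to the coordinates `e` of the vectors of `S` from the `j`-th one on. -/
def ClosureInstance.projections (I : ClosureInstance) {k : ℕ} (e : Fin k → Fin I.n) (j : ℕ) :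
    Set (Fin k → Bool) :=
  {u | ∃ i : Fin I.m, j ≤ i ∧ I.S i ∘ e = u}

/-- The invariant of the scan: started in `s`, it reached `s'` and still has to insert the first `j`
vectors of `S`. -/
structure Scanning (I : ClosureInstance) {k : ℕ} (e : Fin k → Fin I.n) (s : ℕ → ℕ) (j : ℕ)
    (s' : ℕ → ℕ) : Prop where
  left_eq : s' rLeft = j
  row_eq : s' rRow = 2 + I.n + I.n * j
  state_eq : s' rState = setCode (I.projections e j)
  answer_eq : s' rAnswer = s rAnswer
  keeps : Keeps 0 s s'

section TestTuple

variable {F : Set (Operation Bool)} {k W : ℕ} {I : ClosureInstance} {s s' : ℕ → ℕ}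
  {e : Fin k → Fin I.n}

theorem ClosureInstance.projections_zero : I.projections e 0 = (· ∘ e) '' Set.range I.S := by
  ext u
  simp [projections]

theorem ClosureInstance.projections_m : I.projections e I.m = ∅ :=
  Set.eq_empty_of_forall_notMem fun _ ⟨i, hi, _⟩ => hi.not_gt i.isLt

theorem ClosureInstance.projections_eq_insert {j : ℕ} (hj : j < I.m) :
    I.projections e j = insert (I.S ⟨j, hj⟩ ∘ e) (I.projections e (j + 1)) := by
  ext u
  constructor
  · rintro ⟨i, hi, rfl⟩
    rcases hi.eq_or_lt with rfl | hi
    · exact .inl rfl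
    · exact .inr ⟨i, hi, rfl⟩
  · rintro (rfl | ⟨i, hi, rfl⟩)
    · exact ⟨_, le_rfl, rfl⟩
    · exact ⟨i, (Nat.le_succ j).trans hi, rfl⟩

theorem exec_startScan (h : Ready F k I s) (hlen : I.input.length < W) (hm : I.m < W)
    (hW : memorySize k ≤ W) :
    Exec I.input W (.startScan k) 6 s (Scanning I e s I.m) := by
  have hmem : memorySize k = rColumn + k + tableSize k + tableSize k := rfl
  have hempty := setCode_lt_tableSize (∅ : Set (Fin k → Bool))
  rw [ClosureInstance.length_input, Nat.mul_comm I.m] at hlen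
  refine .const (by omega) (.mul ?_ (.add ?_ (.const (by omega) (.add ?_ (.add ?_ (.nil
    { left_eq := ?_, row_eq := ?_, state_eq := ?_, answer_eq := ?_, keeps := ?keeps }))))))
  case keeps =>
    repeat refine .update ?_ (by omega) (by omega)
    exact .refl
  all_goals simp only [Function.update_apply, Nat.reduceEqDiff, reduceIte, h.n_eq, h.m_eq,
    h.zero_eq, ClosureInstance.projections_m]
  all_goals omega

theorem exec_lookupPrevious {base : ℕ} {A : Set (Fin k → Bool)} {u : Fin k → Bool}
    {f : Set (Fin k → Bool) → (Fin k → Bool) → ℕ} (hn : s rN = I.n)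
    (he : ∀ i : Fin k, s (rColumn + i) = e i) (hs' : Keeps 0 s s')
    (hx : ∀ i, I.input[s' rRow - I.n + e i]? = some (u i).toNat) (hlen : I.input.length ≤ W)
    (hA : s' rState = setCode A) (hf : StoresTable s base f) (hbase : rColumn ≤ base)
    (hW : base + tableSize k ≤ W) :
    Exec I.input W (.lookupPrevious k base) (4 * k + 4) s' fun s'' =>
      s'' rState = f A u ∧ s'' rRow = s' rRow - I.n ∧ s'' rLeft = s' rLeft ∧
        s'' rAnswer = s' rAnswer ∧ Keeps 0 s s'' := by
  refine .mono (.seq (t := 1) (t' := 4 * k + 3) (.sub (.nil rfl)) ?_) (by omega) fun _ => id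
  rintro s₁ rfl
  rw [(hs' rN (by simp)).trans hn]
  have hkeeps : Keeps 0 s (Function.update s' rRow (s' rRow - I.n)) :=
    hs'.update (by omega) (by omega)
  have hf' : StoresTable (Function.update s' rRow (s' rRow - I.n)) base f :=
    hf.of_keeps hkeeps hbase
  refine (exec_lookup (s := Function.update s' rRow (s' rRow - I.n)) (u := u) (fun i => ?_) hlen hA
    hf' hbase hW).mono le_rfl fun s₂ ⟨hstate, hframe⟩ => ?_
  · rw [hkeeps (rColumn + i) (.inr (by omega)), he, Function.update_self, hx]
  · refine ⟨hstate, hframe _ (by decide) (by decide), hframe _ (by decide) (by decide),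
      hframe _ (by decide) (by decide), hkeeps.trans fun r hr => ?_⟩
    rw [Set.mem_Icc] at hr
    exact hframe r (by omega) (by omega)

theorem exec_insert {j : ℕ} (hj : j < I.m) (h : Ready F k I s)
    (he : ∀ i : Fin k, s (rColumn + i) = e i) (hlen : I.input.length ≤ W) (hW : memorySize k ≤ W)
    (hs' : Scanning I e s (j + 1) s') :
    Exec I.input W (.lookupPrevious k (insertBase k)) (4 * k + 4) (Function.update s' rLeft j)
      (Scanning I e s j) := by
  have hmem : memorySize k = insertBase k + tableSize k + tableSize k := rfl
  have hrow : s' rRow - I.n = 2 + I.n + I.n * j := by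
    rw [hs'.row_eq, Nat.mul_add_one]
    omega
  refine (exec_lookupPrevious (s' := Function.update s' rLeft j) (u := I.S ⟨j, hj⟩ ∘ e) h.n_eq he
    (hs'.keeps.update (by omega) (by omega)) (fun i => ?_) hlen hs'.state_eq h.insert_table
    (Nat.le_add_right ..) (by omega)).mono le_rfl
    fun s'' ⟨hstate, hrow', hleft, hanswer, hkeeps⟩ => ?_
  · exact hrow ▸ I.getElem?_input_S ⟨j, hj⟩ (e i)
  · exact ⟨hleft, hrow'.trans hrow, by rw [hstate, ClosureInstance.projections_eq_insert hj],
      hanswer.trans hs'.answer_eq, hkeeps⟩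

theorem exec_scan (h : Ready F k I s) (he : ∀ i : Fin k, s (rColumn + i) = e i)
    (hlen : I.input.length ≤ W) (hW : memorySize k ≤ W) (hs' : Scanning I e s I.m s') :
    Exec I.input W (.countdown rLeft (.lookupPrevious k (insertBase k))) (I.m * (4 * k + 7) + 1) s'
      (Scanning I e s 0) :=
  .countdown (t := 4 * k + 4)
    (fun _ _ hs => ⟨hs.left_eq, (hs.keeps _ (by simp)).trans h.one_eq,
      (hs.keeps _ (by simp)).trans h.zero_eq⟩)
    (fun _ hj _ hs => exec_insert hj h he hlen hW hs) hs'

theorem exec_testTuple {P : Prop} (h : Ready F k I s) (he : ∀ i : Fin k, s (rColumn + i) = e i)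
    (hlen : I.input.length < W) (hm : I.m < W) (hW : memorySize k ≤ W)
    (hP : s rAnswer = truthValue P) :
    Exec I.input W (.testTuple k) (I.m * (4 * k + 7) + 4 * k + 12) s fun s' =>
      s' rAnswer = truthValue (P ∧ InClosure F ((· ∘ e) '' Set.range I.S) (I.v ∘ e)) ∧
        Keeps 0 s s' := by
  have hmem : memorySize k = closureBase k + tableSize k := rfl
  have hbase : closureBase k = rColumn + k + tableSize k := rfl
  have hfinal (s₁ : ℕ → ℕ) (hs₁ : Scanning I e s 0 s₁) :=
    exec_lookupPrevious (u := I.v ∘ e) h.n_eq he hs₁.keeps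
      (fun i => by simpa [hs₁.row_eq] using I.getElem?_input_v (e i)) hlen.le hs₁.state_eq
      h.closure_table (by omega) (by omega)
  refine .mono (.seq (exec_startScan h hlen hm hW) fun s₁ hs₁ =>
    .seq (exec_scan h he hlen.le hW hs₁) fun s₂ hs₂ => .seq (hfinal s₂ hs₂)
      fun s₃ ⟨hstate, _, _, hanswer, hkeeps⟩ => (?_ : Exec _ _ _ 1 _ _))
    (by omega) fun _ => id
  have hmul : s₃ rAnswer * s₃ rState =
      truthValue (P ∧ InClosure F ((· ∘ e) '' Set.range I.S) (I.v ∘ e)) := by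
    rw [hanswer, hs₂.answer_eq, hP, hstate, truthValue_mul, ClosureInstance.projections_zero]
  refine .mul ?_ (.nil ⟨by rw [Function.update_self, hmul], hkeeps.trans fun r hr => ?_⟩)
  · exact hmul ▸ (truthValue_le_one _).trans_lt (by omega)
  · rw [Set.mem_Icc] at hr
    exact Function.update_of_ne (by omega) ..

end TestTuple

/-- The column registers hold the coordinates of the tuple `e` from the `l`-th one on. -/
def HoldsTuple {k n : ℕ} (s : ℕ → ℕ) (l : ℕ) (e : Fin k → Fin n) : Prop :=
  ∀ i : Fin k, l ≤ i → s (rColumn + i) = e i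

/-- The fragment `b` conjoins to the truth value in `rAnswer` that `Test` holds for all tuples that
agree with the columns from the `l`-th one on. -/
def TestsTuples (x : List ℕ) (W : ℕ) (s₀ : ℕ → ℕ) {k n : ℕ} (Test : (Fin k → Fin n) → Prop)
    (l : ℕ) (b : Code) (t : ℕ) : Prop :=
  ∀ ⦃s : ℕ → ℕ⦄ ⦃P : Prop⦄, Keeps k s₀ s → (∀ i : Fin k, l ≤ i → s (rColumn + i) < n) →
    s rAnswer = truthValue P → Exec x W b t s fun s' => s' rAnswer = truthValue
      (P ∧ ∀ e : Fin k → Fin n, HoldsTuple s l e → Test e) ∧ Keeps l s s'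

section ForTuples

open Code

variable {x : List ℕ} {W t n k l j : ℕ} {b : Code} {s s' s₀ : ℕ → ℕ} {e : Fin k → Fin n}
  {Test : (Fin k → Fin n) → Prop}

theorem holdsTuple_iff (hl : l < k) (hs : Keeps (l + 1) s s') :
    HoldsTuple s' l e ↔ HoldsTuple s (l + 1) e ∧ s' (rColumn + l) = e ⟨l, hl⟩ := by
  constructor
  · exact fun h => ⟨fun i hi => (hs _ (.inr (by omega))).symm.trans (h i (by omega)),
      h ⟨l, hl⟩ le_rfl⟩
  · rintro ⟨h, hl'⟩ i hi
    rcases hi.eq_or_lt with rfl | hi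
    · exact hl'
    · exact (hs _ (.inr (by omega))).trans (h i hi)

theorem forall_holdsTuple_iff (hl : l < k) (hs : Keeps (l + 1) s s') (hj : s' (rColumn + l) = j) :
    (∀ e : Fin k → Fin n, HoldsTuple s (l + 1) e → j ≤ e ⟨l, hl⟩ → Test e) ↔
      (∀ e : Fin k → Fin n, HoldsTuple s (l + 1) e → j + 1 ≤ e ⟨l, hl⟩ → Test e) ∧
        ∀ e : Fin k → Fin n, HoldsTuple s' l e → Test e := by
  simp only [holdsTuple_iff hl hs, hj]
  constructor
  · exact fun h => ⟨fun e he hje => h e he (by omega), fun e he => h e he.1 he.2.le⟩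
  · rintro ⟨hgt, heq⟩ e he hje
    exact hje.eq_or_lt.elim (fun hje => heq e ⟨he, hje⟩) (hgt e he)

theorem testsTuples_zero
    (hb : ∀ (e : Fin k → Fin n) (P : Prop) (s : ℕ → ℕ), Keeps k s₀ s →
      (∀ i : Fin k, s (rColumn + i) = e i) → s rAnswer = truthValue P →
      Exec x W b t s fun s' => s' rAnswer = truthValue (P ∧ Test e) ∧ Keeps 0 s s') :
    TestsTuples x W s₀ Test 0 b t := by
  intro s P hs hcol hP
  let e (i : Fin k) : Fin n := ⟨s (rColumn + i), hcol i (Nat.zero_le _)⟩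
  have hiff : Test e ↔ ∀ e' : Fin k → Fin n, HoldsTuple s 0 e' → Test e' := by
    refine ⟨fun h e' he' => ?_, fun h => h e fun _ _ => rfl⟩
    have hee' : e = e' := funext fun i => Fin.ext (he' i (Nat.zero_le _))
    rwa [← hee']
  rw [← hiff]
  exact hb e P s hs (fun _ => rfl) hP

theorem TestsTuples.succ (h : TestsTuples x W s₀ Test l b t) (hl : l < k) (hn : s₀ rN = n)
    (hone : s₀ rOne = 1) (hzero : s₀ rZero = 0) (hnW : n < W) :
    TestsTuples x W s₀ Test (l + 1)
      (block [.add (rColumn + l) rN rZero] ;; .countdown (rColumn + l) b) (n * (t + 3) + 2) := by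
  intro s P hs hcol hP
  let Inv (j : ℕ) (s' : ℕ → ℕ) : Prop := s' (rColumn + l) = j ∧ Keeps (l + 1) s s' ∧
    s' rAnswer = truthValue (P ∧ ∀ e : Fin k → Fin n, HoldsTuple s (l + 1) e →
      j ≤ e ⟨l, hl⟩ → Test e)
  have hround (j : ℕ) (hj : j < n) (s' : ℕ → ℕ) (hs' : Inv (j + 1) s') :
      Exec x W b t (Function.update s' (rColumn + l) j) (Inv j) := by
    obtain ⟨-, hkeeps, hanswer⟩ := hs'
    set s₁ := Function.update s' (rColumn + l) j
    have hcol_l : s₁ (rColumn + l) = j := Function.update_self ..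
    have hkeeps₁ : Keeps (l + 1) s s₁ := hkeeps.update (by omega) (by omega)
    have hcol₁ (i : Fin k) (hi : l ≤ i) : s₁ (rColumn + i) < n := by
      rcases hi.eq_or_lt with hi | hi
      · rwa [← hi, hcol_l]
      · exact (hkeeps₁ _ (.inr (by omega))).trans_lt (hcol i hi)
    refine (h (hs.trans (hkeeps₁.mono hl)) hcol₁
      ((Function.update_of_ne (by omega) ..).trans hanswer)).mono le_rfl
      fun s'' ⟨hanswer', hkeeps'⟩ => ⟨(hkeeps' _ (.inr le_rfl)).trans hcol_l,
        hkeeps₁.trans (hkeeps'.mono (Nat.le_succ l)), ?_⟩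
    rw [hanswer', forall_holdsTuple_iff hl hkeeps₁ hcol_l, and_assoc]
  have hlimit : s rN + s rZero = n := by
    rw [hs rN (by simp), hs rZero (by simp), hn, hzero, Nat.add_zero]
  have hInv : Inv n (Function.update s (rColumn + l) n) :=
    ⟨Function.update_self .., Keeps.refl.update (by omega) (by omega), by
      rw [Function.update_of_ne (by omega), hP]
      simp [(Fin.isLt _).not_ge]⟩
  refine .mono (.seq (.add (hlimit ▸ hnW) (.nil (hlimit ▸ hInv))) fun s₁ hs₁ => .countdown
    (Inv := Inv) (fun j s' hs' => ⟨hs'.1, ?_, ?_⟩) hround hs₁) (by omega)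
    fun s' ⟨_, hkeeps, hanswer⟩ => ⟨by simpa using hanswer, hkeeps⟩
  · exact ((hs.trans (hs'.2.1.mono hl)) _ (by simp)).trans hone
  · exact ((hs.trans (hs'.2.1.mono hl)) _ (by simp)).trans hzero

theorem TestsTuples.forTuples (h : TestsTuples x W s₀ Test 0 b t) (hl : l ≤ k) (hn : s₀ rN = n)
    (hone : s₀ rOne = 1) (hzero : s₀ rZero = 0) (hnW : n < W) :
    TestsTuples x W s₀ Test l (.forTuples b l) ((t + 5 * l) * n ^ l + 2) := by
  induction l with
  | zero => exact fun s P hs hcol hP => (h hs hcol hP).mono (by simp) fun _ => id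
  | succ l ih =>
    intro s P hs hcol hP
    refine (((ih (by omega)).succ hl hn hone hzero hnW) hs hcol hP).mono ?_ fun _ => id
    have hpow : n ≤ n ^ (l + 1) := Nat.le_self_pow (Nat.succ_ne_zero l) n
    calc n * ((t + 5 * l) * n ^ l + 2 + 3) + 2
        = (t + 5 * l) * n ^ (l + 1) + 5 * n + 2 := by ring
      _ ≤ (t + 5 * l) * n ^ (l + 1) + 5 * n ^ (l + 1) + 2 := by gcongr
      _ = (t + 5 * (l + 1)) * n ^ (l + 1) + 2 := by ring

end ForTuples

/-- The input parameters `n` and `m` are read into registers. -/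
def Code.readSizes : Code := block [.const rOne 1, .read rN rZero, .read rM rOne]

/-- The two tables are written and the answer is initialized to "yes". -/
noncomputable def Code.writeTables (F : Set (Operation Bool)) (k : ℕ) : Code :=
  writeTable (insertBase k) (tableEntry fun A (u : Fin k → Bool) => setCode (insert u A))
      (tableSize k) ;;
    writeTable (closureBase k) (tableEntry fun A (u : Fin k → Bool) =>
      truthValue (InClosure F A u)) (tableSize k) ;; block [.const rAnswer 1]

/-- The program for the closure problem. If `m = 0`, it answers "no" without any tests: the closure
of the empty set is empty, but for `n = 0` there is no tuple of coordinates that reveals this. -/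
noncomputable def Code.decideClosure (F : Set (Operation Bool)) (k : ℕ) : Code :=
  readSizes ;; unlessZero rM (writeTables F k ;; forTuples (testTuple k) k)

section DecideClosure

variable {F : Set (Operation Bool)} {k W : ℕ} {I : ClosureInstance} {s : ℕ → ℕ}

theorem exec_readSizes (hn : I.n < W) (hm : I.m < W) (hW : 1 < W) :
    Exec I.input W .readSizes 3 (fun _ => 0) fun s =>
      s rAnswer = 0 ∧ s rN = I.n ∧ s rM = I.m ∧ s rOne = 1 ∧ s rZero = 0 := by
  refine .const hW (.read ?_ (.read ?_ (.nil ?_)))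
  all_goals simp [ClosureInstance.input_eq, hn, hm]

theorem exec_writeTables {x : List ℕ} (hn : s rN = I.n) (hm : s rM = I.m) (hone : s rOne = 1)
    (hzero : s rZero = 0) (hW : memorySize k ≤ W) :
    Exec x W (.writeTables F k) (2 * tableSize k + 1) s fun s' =>
      s' rAnswer = truthValue True ∧ Ready F k I s' := by
  have hmem : memorySize k = rColumn + k + tableSize k + tableSize k := rfl
  have hinsert : insertBase k = rColumn + k := rfl
  have hclosure : closureBase k = insertBase k + tableSize k := rfl
  have hinsert_lt := tableEntry_lt (W := W) (by omega) fun A (u : Fin k → Bool) =>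
    (setCode_lt_tableSize (insert u A)).trans_le (by omega)
  have hclosure_lt := tableEntry_lt (W := W) (by omega) fun A (u : Fin k → Bool) =>
    (truthValue_le_one (InClosure F A u)).trans_lt (by omega)
  refine .mono (.seq (exec_writeTable fun i _ => hinsert_lt i) fun s₁ ⟨htable₁, hframe₁⟩ =>
    .seq (exec_writeTable fun i _ => hclosure_lt i) fun s₂ ⟨htable₂, hframe₂⟩ =>
      .const (by omega) (.nil ⟨by simp [truthValue], ?_⟩)) (by omega) fun _ => id
  have hlow (r : ℕ) (hr : r ∈ Set.Icc rN rZero) : Function.update s₂ rAnswer 1 r = s r := by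
    rw [Set.mem_Icc] at hr
    rw [Function.update_of_ne (by omega), hframe₂ r (by omega), hframe₁ r (by omega)]
  refine ⟨(hlow _ (by simp)).trans hn, (hlow _ (by simp)).trans hm, (hlow _ (by simp)).trans hone,
    (hlow _ (by simp)).trans hzero, fun A u => ?_, fun A u => ?_⟩
  all_goals
    have hlt := appendBits_setCode_lt A u
    rw [Function.update_of_ne (by omega)]
  · rw [hframe₂ _ (by omega), htable₁ _ hlt, tableEntry_appendBits]
  · rw [htable₂ _ hlt, tableEntry_appendBits]

theorem exec_forTuples_testTuple (h : Ready F k I s) (hlen : I.input.length < W)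
    (hm : I.m < W) (hW : memorySize k ≤ W) (hanswer : s rAnswer = truthValue True) :
    Exec I.input W (.forTuples (.testTuple k) k)
      ((I.m * (4 * k + 7) + 4 * k + 12 + 5 * k) * I.n ^ k + 2) s fun s' => s' rAnswer =
        truthValue (∀ e : Fin k → Fin I.n,
          InClosure F ((· ∘ e) '' Set.range I.S) (I.v ∘ e)) := by
  refine ((testsTuples_zero fun e P s' hs' he hP =>
    exec_testTuple (h.of_keeps hs') he hlen hm hW hP).forTuples le_rfl h.n_eq h.one_eq h.zero_eq
      (ClosureInstance.n_lt_length_input.trans hlen) .refl (fun i hi => absurd i.isLt hi.not_gt)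
      hanswer).mono le_rfl fun s' ⟨hs', _⟩ => ?_
  have hholds (e : Fin k → Fin I.n) : HoldsTuple s k e := fun i hi => absurd i.isLt hi.not_gt
  simpa only [true_and, hholds, true_imp_iff] using hs'

theorem exec_decideClosure {f : Operation Bool} (hfF : f ∈ F) (hf : f.IsNearUnanimity)
    (hk : f.arity ≤ k + 1) (hlen : I.input.length < W) (hm : I.m < W) (hW : memorySize k ≤ W) :
    Exec I.input W (.decideClosure F k)
      (3 + (2 * tableSize k + (13 * k + 19) * (I.m * I.n ^ k) + 3 + 1)) (fun _ => 0) fun s =>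
        s rAnswer = truthValue (InClosure F (Set.range I.S) I.v) := by
  have hmem : memorySize k = rColumn + k + tableSize k + tableSize k := rfl
  have hn : I.n < W := ClosureInstance.n_lt_length_input.trans hlen
  refine .seq (exec_readSizes hn hm (by omega)) fun s ⟨hanswer, hsn, hsm, hone, hzero⟩ =>
    .unlessZero (fun hm0 => ?_) fun hm0 => ?_
  · have : IsEmpty (Fin I.m) := hsm ▸ hm0 ▸ Fin.isEmpty
    simp [hanswer, truthValue, Set.range_eq_empty, not_inClosure_empty]
  · have hS : (Set.range I.S).Nonempty := ⟨_, ⟨0, by omega⟩, rfl⟩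
    rw [inClosure_iff_forall_comp hfF hf hk hS]
    have htime : (I.m * (4 * k + 7) + 4 * k + 12 + 5 * k) * I.n ^ k ≤
        (13 * k + 19) * (I.m * I.n ^ k) := by
      rw [← mul_assoc]
      exact Nat.mul_le_mul_right _ (by nlinarith [Nat.one_le_iff_ne_zero.mpr (hsm ▸ hm0)])
    exact .mono (.seq (exec_writeTables hsn hsm hone hzero hW) fun s' ⟨hanswer', hready⟩ =>
      exec_forTuples_testTuple hready hlen hm hW hanswer') (by omega) fun _ => id

theorem solvableInTime_closureProblem {f : Operation Bool} (hfF : f ∈ F) (hf : f.IsNearUnanimity)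
    (hk : f.arity ≤ k + 1) :
    SolvableInTime (closureProblem F) fun I : ClosureInstance => I.m * I.n ^ k := by
  refine ⟨Code.decideClosure F k 0, 13 * k + 2 * tableSize k + 19, fun I => ?_⟩
  set c := 13 * k + 2 * tableSize k + 19
  set N := I.input.length + I.input.sum + 1
  have hsum := I.m_le_sum_input
  have hsize : 0 < Nat.size N := Nat.size_pos.mpr (Nat.succ_pos _)
  have hN_lt : N < 2 ^ (c * Nat.size N) := (Nat.lt_size_self N).trans_le
    (Nat.pow_le_pow_right two_pos (Nat.le_mul_of_pos_left _ (Nat.succ_pos _)))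
  have hc_lt : c < 2 ^ (c * Nat.size N) := Nat.lt_two_pow_self.trans_le
    (Nat.pow_le_pow_right two_pos (Nat.le_mul_of_pos_right _ hsize))
  have hmem : memorySize k ≤ c := by
    simp only [memorySize, closureBase, insertBase, c]
    omega
  refine decidesWithin_of_exec ((exec_decideClosure hfF hf hk (by omega) (by omega)
    (hmem.trans hc_lt.le)).mono ?_ fun s hs => ?_)
  · change _ ≤ (13 * k + 2 * tableSize k + 19) * (I.m * I.n ^ k + 1)
    linarith [Nat.zero_le (tableSize k * (I.m * I.n ^ k))]
  by_cases h : InClosure F (Set.range I.S) I.v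
  · exact .inl ⟨h, by rw [hs, truthValue, if_pos h]⟩
  · exact .inr ⟨h, by rw [hs, truthValue, if_neg h]⟩

end DecideClosure

/-! ### Polynomial time -/

theorem DecidesWithin.mono {P : DecisionProblem} {p : List Instr} {I : P.Instance}
    {t t' w w' : ℕ} (h : DecidesWithin P p I t w) (ht : t ≤ t') (hw : w ≤ w') :
    DecidesWithin P p I t' w' := by
  obtain ⟨u, hu, hhalt, hanswer, hlt⟩ := h
  exact ⟨u, hu.trans ht, hhalt, hanswer, fun u' hu' r =>
    (hlt u' hu' r).trans_le (Nat.pow_le_pow_right two_pos hw)⟩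

theorem bitSize_cons (a : ℕ) (x : List ℕ) : bitSize (a :: x) = Nat.size a + 1 + bitSize x := by
  simp only [bitSize, List.map_cons, List.sum_cons]

theorem length_le_bitSize (x : List ℕ) : x.length ≤ bitSize x := by
  induction x with
  | nil => exact Nat.zero_le _
  | cons a x ih =>
    rw [bitSize_cons, List.length_cons]
    omega

theorem length_add_sum_lt (x : List ℕ) : x.length + x.sum < 2 ^ bitSize x := by
  induction x with
  | nil => exact Nat.two_pow_pos _
  | cons a x ih =>
    have ha : a + 1 ≤ 2 ^ Nat.size a := Nat.lt_size_self a
    have hpos : 0 < 2 ^ bitSize x := Nat.two_pow_pos _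
    rw [bitSize_cons, pow_add, pow_succ, List.length_cons, List.sum_cons]
    nlinarith

theorem inP_of_solvableInTime {P : DecisionProblem} {T : P.Instance → ℕ} (q : Polynomial ℕ)
    (hT : ∀ I, T I ≤ q.eval (bitSize (P.input I))) (h : SolvableInTime P T) : InP P := by
  obtain ⟨p, c, h⟩ := h
  refine ⟨p, .C c * (q + .X + 1), fun I => (h I).mono ?_ ?_⟩
  all_goals
    simp only [Polynomial.eval_mul, Polynomial.eval_C, Polynomial.eval_add, Polynomial.eval_X,
      Polynomial.eval_one]
    refine Nat.mul_le_mul_left _ ?_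
  · have := hT I
    omega
  · have hsize : Nat.size ((P.input I).length + (P.input I).sum + 1) ≤ bitSize (P.input I) + 1 :=
      Nat.size_le.mpr ((Nat.succ_le_of_lt (length_add_sum_lt _)).trans_lt
        (Nat.pow_lt_pow_succ one_lt_two))
    omega

theorem ClosureInstance.mul_pow_le_bitSize_pow (I : ClosureInstance) {k : ℕ} (hk : k ≠ 0) :
    I.m * I.n ^ k ≤ bitSize I.input ^ k := by
  have hlen := length_le_bitSize I.input
  rw [length_input] at hlen
  calc I.m * I.n ^ k = I.m * I.n * I.n ^ (k - 1) := by rw [mul_assoc, mul_pow_sub_one hk]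
    _ ≤ bitSize I.input * bitSize I.input ^ (k - 1) := by gcongr <;> omega
    _ = bitSize I.input ^ k := mul_pow_sub_one hk _

end CloneClosure

theorem mainTheorem8_general {k : ℕ} {F : Set (CloneClosure.Operation Bool)}
    {f : CloneClosure.Operation Bool} (hfF : f ∈ F) (hf : f.IsNearUnanimity)
    (hk : f.arity ≤ k + 1) :
    CloneClosure.SolvableInTime (CloneClosure.closureProblem F)
        (fun I : CloneClosure.ClosureInstance => I.m * I.n ^ k) ∧
      CloneClosure.InP (CloneClosure.closureProblem F) := by
  have hk0 : k ≠ 0 := by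
    have := hf.one_lt_arity
    omega
  have htime := CloneClosure.solvableInTime_closureProblem hfF hf hk
  exact ⟨htime, CloneClosure.inP_of_solvableInTime (.X ^ k)
    (fun I => by
      rw [Polynomial.eval_pow, Polynomial.eval_X]
      exact I.mul_pow_le_bitSize_pow hk0) htime⟩

theorem mainTheorem8 :
    (∀ (k : ℕ) (F : Set (CloneClosure.Operation Bool)), 2 ≤ k → CloneClosure.IsClone F →
      CloneClosure.threshold k ∈ F →
      CloneClosure.SolvableInTime (CloneClosure.closureProblem F)
        (fun I : CloneClosure.ClosureInstance => I.m * I.n ^ k)) ∧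
    (∀ k : ℕ, 2 ≤ k →
      CloneClosure.InP (CloneClosure.closureProblem (CloneClosure.S10 k)) ∧
      CloneClosure.InP (CloneClosure.closureProblem (CloneClosure.S12 k))) ∧
    CloneClosure.InP (CloneClosure.closureProblem CloneClosure.D1) :=
  ⟨fun _ _ hk _ hF =>
      (mainTheorem8_general hF (CloneClosure.isNearUnanimity_threshold hk) le_rfl).1,
    fun _ hk =>
      have hth := CloneClosure.isNearUnanimity_threshold hk
      ⟨(mainTheorem8_general (.basic _ (.inl rfl)) hth le_rfl).2,
        (mainTheorem8_general (.basic _ (.inl rfl)) hth le_rfl).2⟩,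
    (mainTheorem8_general (k := 2) (.basic _ (.inl rfl)) CloneClosure.isNearUnanimity_maj le_rfl).2⟩
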